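/- Let $Y=\{y_s\}_{s\ge 1}$ be totally ordered by $y_1>y_2>y_3>\cdots$, let $Y^*$ be the set of words over $Y$ (including the empty word $1$) with the lexicographic order (a proper prefix of a word is smaller than the word), and let $|w|=r$ and $(w)=s_1+\cdots+s_r$ be the length and the weight of $w=y_{s_1}\cdots y_{s_r}$. Let $\langle\,\cdot\mid\cdot\,\rangle$ be the bilinear form on $\mathbb{Q}\langle Y\rangle$ for which the words are orthonormal. A Lyndon word is a nonempty word smaller than each of its nonempty proper right factors. The standard factorization of a Lyndon word $l$ with $|l|\ge 2$ is $l=l_1l_2$, where $l_2$ is the smallest nonempty proper right factor of $l$. The quasi-shuffle product $\star$ on $\mathbb{Q}\langle Y\rangle$ is the bilinear product with $w\star 1=1\star w=w$ and $y_su\star y_tv=y_s(u\star y_tv)+y_t(y_su\star v)+y_{s+t}(u\star v)$. For a word $w$ put $$\pi_1(w)=w+\sum_{k=2}^{(w)}\frac{(-1)^{k-1}}{k}\sum_{u_1,\dots,u_k\in Y^*\setminus\{1\}}\langle w\mid u_1\star\cdots\star u_k\rangle\,u_1\cdots u_k .$$ Let $P_{y_s}=y_s$ and $\Pi_{y_s}=\pi_1(y_s)$;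 let $P_l=[P_{l_1},P_{l_2}]$ and $\Pi_l=[\Pi_{l_1},\Pi_{l_2}]$ for a Lyndon word $l$ of length at least $2$ with standard factorization $(l_1,l_2)$; and let $P_w=P_{l_1}^{i_1}\cdots P_{l_k}^{i_k}$ and $\Pi_w=\Pi_{l_1}^{i_1}\cdots\Pi_{l_k}^{i_k}$ for $w=l_1^{i_1}\cdots l_k^{i_k}$ with Lyndon words $l_1>\cdots>l_k$ (so $P_1=\Pi_1=1$). Then there are unique families $(S_w)_{w\in Y^*}$ and $(\Sigma_w)_{w\in Y^*}$ in $\mathbb{Q}\langle Y\rangle$ with $\langle P_u\mid S_v\rangle=\delta_{u,v}$ and $\langle\Pi_u\mid\Sigma_v\rangle=\delta_{u,v}$ for all $u,v\in Y^*$. For every $w\in Y^*$ there are rational coefficients, all but finitely many of them zero, such that $$w=P_w+\sum_{u>w,\ |u|=|w|}\alpha^1_u P_u=S_w+\sum_{u<w,\ |u|=|w|}\alpha^2_u S_u,$$ $$w=\Pi_w+\sum_{v>w,\ (v)=(w)}\beta^1_v\Pi_v=\Sigma_w+\sum_{v<w,\ (v)=(w)}\beta^2_v\Sigma_v .$$ 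-/

import Mathlib

namespace PBW

/-- The alphabet `Y = {y_s}_{s ≥ 1}`.  The order dual encodes `y_1 > y_2 > y_3 > …`. -/
abbrev Letter : Type := ℕ+ᵒᵈ

/-- The letter `y_s`. -/
def y (s : ℕ+) : Letter := OrderDual.toDual s

/-- The index `s` of the letter `y_s`. -/
def idx (a : Letter) : ℕ+ := OrderDual.ofDual a

/-- Words over `Y`.  The order `<` on words is Mathlib's order on lists: the lexicographic order,
in which a proper prefix of a word is smaller than the word. -/
abbrev Word : Type := List Letter

/-- The weight of `y_{s_1} ⋯ y_{s_r}` is `s_1 + ⋯ + s_r`. -/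
def weight (w : Word) : ℕ := (w.map fun a => (idx a : ℕ)).sum

/-- Noncommutative polynomials `ℚ⟨Y⟩`; the product `*` is the concatenation. -/
abbrev Poly : Type := MonoidAlgebra ℚ (FreeMonoid Letter)

/-- A word, seen as a polynomial. -/
noncomputable def mono (w : Word) : Poly := MonoidAlgebra.single (FreeMonoid.ofList w) 1

/-- The coefficient `⟨p | w⟩` of the word `w` in the polynomial `p`. -/
noncomputable def coeff (p : Poly) (w : Word) : ℚ := p.coeff (FreeMonoid.ofList w)

/-- The pairing `⟨p | q⟩ = ∑_w ⟨p | w⟩ ⟨q | w⟩`, for which the words are orthonormal. -/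
noncomputable def pairing (p q : Poly) : ℚ := p.coeff.sum fun w a => a * q.coeff w

/-! ### Lyndon words -/

/-- A Lyndon word: a nonempty word smaller than each of its nonempty proper right factors. -/
def IsLyndon (w : Word) : Prop :=
  w ≠ [] ∧ ∀ u v : Word, u ≠ [] → v ≠ [] → w = u ++ v → w < v

/-- The smallest nonempty right factor of a nonempty word. -/
def minSuffix : Word → Word
  | [] => []
  | [a] => [a]
  | a :: b :: t => min (a :: b :: t) (minSuffix (b :: t))

theorem minSuffix_ne_nil : ∀ w : Word, w ≠ [] → minSuffix w ≠ []
  | [], h => absurd rfl h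
  | [a], _ => by simp [minSuffix]
  | a :: b :: t, _ => by
    rw [minSuffix]
    rcases min_choice (a :: b :: t) (minSuffix (b :: t)) with h | h <;> rw [h]
    · simp
    · exact minSuffix_ne_nil (b :: t) (by simp)

theorem minSuffix_suffix : ∀ w : Word, minSuffix w <:+ w
  | [] => by simp [minSuffix]
  | [a] => by simp [minSuffix]
  | a :: b :: t => by
    rw [minSuffix]
    rcases min_choice (a :: b :: t) (minSuffix (b :: t)) with h | h <;> rw [h]
    exact (minSuffix_suffix (b :: t)).trans (List.suffix_cons a (b :: t))

theorem minSuffix_le : ∀ w v : Word, v ≠ [] → v <:+ w → minSuffix w ≤ v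
  | [], v, hv, h => absurd (List.suffix_nil.mp h) hv
  | [a], v, hv, h => by
    rcases List.suffix_cons_iff.mp h with h | h
    · rw [h, minSuffix]
    · exact absurd (List.suffix_nil.mp h) hv
  | a :: b :: t, v, hv, h => by
    rw [minSuffix]
    rcases List.suffix_cons_iff.mp h with h | h
    · rw [h]; exact min_le_left _ _
    · exact (min_le_right _ _).trans (minSuffix_le (b :: t) v hv h)

/-- The right part `l_2` of the standard factorization `(l_1, l_2)` of a Lyndon word `l` of length
at least two: the smallest nonempty proper right factor of `l`. -/
def stRight (l : Word) : Word := minSuffix l.tail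

/-- The left part `l_1` of the standard factorization, so that `l = l_1 l_2`. -/
def stLeft (l : Word) : Word := l.take (l.length - (stRight l).length)

theorem stLeft_append_stRight (l : Word) : stLeft l ++ stRight l = l := by
  have h : stRight l <:+ l := (minSuffix_suffix _).trans (List.tail_suffix l)
  obtain ⟨t, ht⟩ := h
  have hl : l.length = t.length + (stRight l).length := by
    conv_lhs => rw [← ht]
    simp
  have : stLeft l = t := by
    rw [stLeft, hl, Nat.add_sub_cancel]
    conv_lhs => rw [← ht]
    simp
  rw [this, ht]

theorem length_stRight_lt (l : Word) (h : 2 ≤ l.length) : (stRight l).length < l.length := by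
  have := (minSuffix_suffix l.tail).length_le
  rw [List.length_tail] at this
  unfold stRight
  omega

theorem length_stLeft_lt (l : Word) (h : 2 ≤ l.length) : (stLeft l).length < l.length := by
  have h1 : stRight l ≠ [] := by
    apply minSuffix_ne_nil
    intro h0
    have := congrArg List.length h0
    rw [List.length_tail, List.length_nil] at this
    omega
  have h2 := List.length_pos_of_ne_nil h1
  have h3 := congrArg List.length (stLeft_append_stRight l)
  rw [List.length_append] at h3
  omega

/-- `L = [l_1, …, l_n]` is the factorization of `w` as a nonincreasing product
`w = l_1 ⋯ l_n`, `l_1 ≥ ⋯ ≥ l_n`, of Lyndon words. -/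
def IsLyndonFactorization (w : Word) (L : List Word) : Prop :=
  (∀ l ∈ L, IsLyndon l) ∧ L.Pairwise (fun l l' => l' ≤ l) ∧ L.flatten = w

theorem lt_cases : ∀ (l m : Word), l < m →
    (∃ t : Word, t ≠ [] ∧ m = l ++ t) ∨ ∀ x : Word, l ++ x < m
  | [], [], h => absurd h (lt_irrefl _)
  | [], b :: m, _ => Or.inl ⟨b :: m, by simp, rfl⟩
  | a :: l, [], h => absurd h (by simp)
  | a :: l, b :: m, h => by
    rcases List.cons_lt_cons_iff.mp h with h | ⟨h, h'⟩
    · exact Or.inr fun x => List.cons_lt_cons_iff.mpr (Or.inl h)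
    · subst h
      rcases lt_cases l m h' with ⟨t, ht, e⟩ | h'
      · exact Or.inl ⟨t, ht, by rw [e]; rfl⟩
      · exact Or.inr fun x => List.cons_lt_cons_iff.mpr (Or.inr ⟨rfl, h' x⟩)

theorem isLyndon_minSuffix (w : Word) (hw : w ≠ []) : IsLyndon (minSuffix w) := by
  refine ⟨minSuffix_ne_nil w hw, fun u v hu hv h => lt_of_le_of_ne ?_ ?_⟩
  · refine minSuffix_le w v hv (List.IsSuffix.trans ⟨u, h.symm⟩ (minSuffix_suffix w))
  · intro e
    rw [e] at h
    exact hu (List.self_eq_append_left.mp h)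

theorem le_of_minimal (l m : Word) (hl : l ≠ [])
    (h : ∀ v : Word, v ≠ [] → v <:+ l ++ m → m ≤ v) : m ≤ l := by
  by_contra hlt
  rcases lt_cases l m (not_le.mp hlt) with ⟨t, ht, e⟩ | h'
  · have h1 : m ≤ t := h t ht (by rw [e]; exact ⟨l ++ l, by simp⟩)
    have h2 : l ++ m ≤ l ++ t := by
      rcases h1.lt_or_eq with h1 | h1
      · exact (List.append_left_lt h1).le
      · rw [h1]
    rw [← e] at h2
    have h3 : m ≤ l ++ m := h _ (by simp [hl]) List.suffix_rfl
    have h4 := congrArg List.length (le_antisymm h3 h2)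
    rw [List.length_append] at h4
    have := List.length_pos_of_ne_nil hl
    omega
  · exact absurd (h' m) (not_lt.mpr (h _ (by simp [hl]) List.suffix_rfl))

theorem exists_isLyndonFactorization (w : Word) : ∃ L, IsLyndonFactorization w L := by
  by_cases hw : w = []
  · exact ⟨[], by simp [IsLyndonFactorization, hw]⟩
  obtain ⟨u, hu⟩ := minSuffix_suffix w
  have hm := minSuffix_ne_nil w hw
  have hlen : u.length < w.length := by
    have := congrArg List.length hu
    rw [List.length_append] at this
    have := List.length_pos_of_ne_nil hm
    omega
  obtain ⟨L, h1, h2, h3⟩ := exists_isLyndonFactorization u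
  refine ⟨L ++ [minSuffix w], ?_, ?_, by simp [h3, hu]⟩
  · intro l hl
    rcases List.mem_append.mp hl with hl | hl
    · exact h1 l hl
    · rw [List.mem_singleton.mp hl]; exact isLyndon_minSuffix w hw
  · rcases List.eq_nil_or_concat L with hL | ⟨K, k, hL⟩
    · simp [hL]
    · have hk : minSuffix w ≤ k := by
        refine le_of_minimal k _ (h1 k (by simp [hL])).1 fun v hv hs => ?_
        refine minSuffix_le w v hv (hs.trans ⟨K.flatten, ?_⟩)
        conv_rhs => rw [← hu, ← h3, hL]
        simp
      refine List.pairwise_append.mpr ⟨h2, by simp, ?_⟩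
      intro a ha b hb
      rw [List.mem_singleton.mp hb]
      rw [hL, List.concat_eq_append] at ha h2
      rcases List.mem_append.mp ha with ha | ha
      · exact hk.trans ((List.pairwise_append.mp h2).2.2 a ha k (by simp))
      · rw [List.mem_singleton.mp ha]; exact hk
termination_by w.length

theorem IsLyndonFactorization.last_eq {w : Word} {K : List Word} {k : Word}
    (h : IsLyndonFactorization w (K ++ [k])) : k = minSuffix w := by
  obtain ⟨h1, h2, h3⟩ := h
  have key : ∀ (K : List Word), (∀ l ∈ K, IsLyndon l ∧ k ≤ l) →
      ∀ v : Word, v ≠ [] → v <:+ K.flatten ++ k → k ≤ v := by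
    have hk : IsLyndon k := h1 k (by simp)
    have tail : ∀ l : Word, IsLyndon l → ∀ v : Word, v ≠ [] → v <:+ l → l ≤ v := by
      rintro l hl v hv ⟨t, ht⟩
      by_cases h0 : t = []
      · rw [← ht, h0]; simp
      · exact (hl.2 t v h0 hv ht.symm).le
    intro K
    induction K with
    | nil => intro _ v hv hs; exact tail k hk v hv (by simpa using hs)
    | cons l K ih =>
      intro hK v hv hs
      rw [List.flatten_cons, List.append_assoc] at hs
      have hs' : v <:+ K.flatten ++ k ∨ ∃ t, v = t ++ (K.flatten ++ k) ∧ t <:+ l := by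
        obtain ⟨x, hx⟩ := hs
        rcases List.append_eq_append_iff.mp hx with ⟨t, e1, e2⟩ | ⟨t, e1, e2⟩
        · exact Or.inr ⟨t, e2, ⟨x, e1.symm⟩⟩
        · exact Or.inl ⟨t, e2.symm⟩
      rcases hs' with hs | ⟨t, e, hs⟩
      · exact ih (fun l hl => hK l (List.mem_cons_of_mem _ hl)) v hv hs
      · by_cases h0 : t = []
        · refine ih (fun l hl => hK l (List.mem_cons_of_mem _ hl)) v hv ?_
          rw [e, h0]; simp
        · have hl := hK l (by simp)
          refine (hl.2.trans (tail l hl.1 t h0 hs)).trans ?_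
          rw [e]
          refine not_lt.mp ?_
          exact List.le_append_left (α := Letter) (l₁ := t) (l₂ := K.flatten ++ k)
  refine le_antisymm ?_ ?_
  · have hw : w ≠ [] := by
      rw [← h3]
      simpa using fun _ => (h1 k (by simp)).1
    refine key K (fun l hl => ⟨h1 l (by simp [hl]), ?_⟩) _ (minSuffix_ne_nil w hw) ?_
    · exact (List.pairwise_append.mp h2).2.2 l hl k (by simp)
    · have := minSuffix_suffix w
      conv_rhs at this => rw [← h3]
      simpa using this
  · exact minSuffix_le w k (h1 k (by simp)).1 ⟨K.flatten, by rw [← h3]; simp⟩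

theorem IsLyndonFactorization.unique {w : Word} {L L' : List Word}
    (h : IsLyndonFactorization w L) (h' : IsLyndonFactorization w L') : L = L' := by
  induction L using List.reverseRecOn generalizing w L' with
  | nil =>
    rcases List.eq_nil_or_concat L' with hL | ⟨K, k, hL⟩
    · exact hL.symm
    · exfalso
      rw [hL, List.concat_eq_append] at h'
      have := h.2.2.trans h'.2.2.symm
      have hk := (h'.1 k (by simp)).1
      simp [hk] at this
  | append_singleton K k ih =>
    rcases List.eq_nil_or_concat L' with hL | ⟨K', k', hL⟩
    · exfalso
      rw [hL] at h'
      have := h'.2.2.trans h.2.2.symm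
      have hk := (h.1 k (by simp)).1
      simp [hk] at this
    · rw [List.concat_eq_append] at hL
      subst hL
      have e : k = k' := h.last_eq.trans h'.last_eq.symm
      subst e
      have hf : K.flatten = K'.flatten := by
        have := h.2.2.trans h'.2.2.symm
        simpa using this
      rw [ih (w := K.flatten) (L' := K')
        ⟨fun l hl => h.1 l (by simp [hl]), (List.pairwise_append.mp h.2.1).1, rfl⟩
        ⟨fun l hl => h'.1 l (by simp [hl]), (List.pairwise_append.mp h'.2.1).1, hf.symm⟩]

/-- The nonincreasing list of the Lyndon factors of `w`; it exists and, by
`IsLyndonFactorization.unique`, it is unique. -/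
noncomputable def lyndonFactors (w : Word) : List Word :=
  (exists_isLyndonFactorization w).choose

/-! ### The bases `P` and `S` -/

/-- The element attached to a Lyndon word by the rules `y_s ↦ g y_s` on letters and
`l ↦ [l_1, l_2]` (commutator) for the standard factorization `(l_1, l_2)` of a Lyndon word `l` of
length at least two. -/
noncomputable def bracket (g : Letter → Poly) : Word → Poly
  | [] => 0
  | [a] => g a
  | a :: b :: t =>
    bracket g (stLeft (a :: b :: t)) * bracket g (stRight (a :: b :: t)) -
      bracket g (stRight (a :: b :: t)) * bracket g (stLeft (a :: b :: t))
termination_by w => w.length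
decreasing_by
  all_goals first
    | exact length_stLeft_lt _ (by simp)
    | exact length_stRight_lt _ (by simp)

/-- The family attached to all words: `w = l_1^{i_1} ⋯ l_k^{i_k}`, with Lyndon words
`l_1 > ⋯ > l_k`, is sent to the product of the corresponding powers of the elements attached to
the Lyndon factors, in this order. -/
noncomputable def pbwFamily (g : Letter → Poly) (w : Word) : Poly :=
  ((lyndonFactors w).map (bracket g)).prod

/-- `C` is dual to `B`: `⟨B_u | C_v⟩ = δ_{u,v}`. -/
def IsDual (B C : Word → Poly) : Prop :=
  ∀ u v : Word, pairing (B u) (C v) = if u = v then 1 else 0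

open Classical in
/-- The family of polynomials dual to `B` (the zero family if there is none). -/
noncomputable def dualFamily (B : Word → Poly) : Word → Poly :=
  if h : ∃ C, IsDual B C then h.choose else 0

/-- The PBW basis `P_w` of the free Lie algebra's enveloping algebra: `P_{y_s} = y_s`. -/
noncomputable def P : Word → Poly := pbwFamily fun a => mono [a]

/-- The basis `S_w` dual to `P_w`. -/
noncomputable def S : Word → Poly := dualFamily P

/-! ### The bases `Pi` and `Sigma` -/

/-- The quasi-shuffle product of two words. -/
noncomputable def stuffle : Word → Word → Poly
  | [], v => mono v
  | a :: u, [] => mono (a :: u)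
  | a :: u, b :: v =>
    mono [a] * stuffle u (b :: v) + mono [b] * stuffle (a :: u) v +
      mono [y (idx a + idx b)] * stuffle u v
termination_by u v => u.length + v.length

/-- The quasi-shuffle product, extended bilinearly to polynomials. -/
noncomputable def stufflePoly (p q : Poly) : Poly :=
  p.coeff.sum fun u a => q.coeff.sum fun v b =>
    (a * b) • stuffle (FreeMonoid.toList u) (FreeMonoid.toList v)

/-- The quasi-shuffle product of a list of words. -/
noncomputable def stuffleList (L : List Word) : Poly :=
  L.foldr (fun u p => stufflePoly (mono u) p) 1

/-- The projection `π_1` onto the primitive elements of the quasi-shuffle Hopf algebra, on words: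
`π_1(w) = w + ∑_{k=2}^{(w)} (-1)^{k-1}/k ∑_{u_1,…,u_k ≠ 1} ⟨w | u_1 ⋆ ⋯ ⋆ u_k⟩ u_1 ⋯ u_k`.
The inner sum has finitely many nonzero terms, as `⋆` is homogeneous for the weight. -/
noncomputable def piOne (w : Word) : Poly :=
  mono w + ∑ k ∈ Finset.Icc 2 (weight w), ((-1 : ℚ) ^ (k - 1) / (k : ℚ)) •
    ∑ᶠ L : {L : List Word // L.length = k ∧ [] ∉ L},
      coeff (stuffleList L.1) w • mono L.1.flatten

/-- The PBW basis `Π_w` for the quasi-shuffle Hopf algebra: `Π_{y_s} = π_1(y_s)`. -/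
noncomputable def Pi : Word → Poly := pbwFamily fun a => piOne [a]

/-- The basis `Σ_w` dual to `Π_w`. -/
noncomputable def Sigma : Word → Poly := dualFamily Pi

end PBW

/-!
The bases `P` and `Pi` are unitriangular with respect to the words, and the rest is linear algebra.

Call `w` the leading word of `p` if `p` is `w` plus a combination of words that exceed `w` at a
letter (`HasLeading`). This strict form of the lexicographic order, unlike `<` itself, survives
appending arbitrary words on the right, so leading words multiply (`HasLeading.mul`) even when the
words involved have different lengths. For a Lyndon word `l` with standard factorization
`l = l₁ l₂` the word `l₂ l₁` has the same length as `l` and is larger, so in the commutator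
`[p₁, p₂]` of elements with leading words `l₁` and `l₂` only the first product contributes to the
leading word, which is `l` (`hasLeading_bracket`). Taking products, every family built by
`pbwFamily` from letters `g y_s` with leading words `y_s` has the leading words `w`
(`hasLeading_pbwFamily`). For `P` the hypothesis on the letters is trivial; for `Pi` it holds because
the quasi-shuffle product is homogeneous for the weight, so that `π_1(y_s) - y_s` involves only
words of weight `s` and length at least two, whose first letter is larger than `y_s`
(`hasLeading_piOne`).

All of this respects a degree: the pair of length and weight for `P`, the weight alone for `Pi`. As
only finitely many words have a given weight, a unitriangular family can be inverted by induction
(`sub_mem_span_of_unitriangular`). The inverse coefficients are the coefficients of the only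
possible dual family (`isDual_iff_coeff`), which is therefore unitriangular for the reversed order,
and inverting once more expands the words in it (`duality_of_unitriangular`).
-/

namespace PBW

/-! ### Triangular changes of family -/

/-- If every element of `B` is the corresponding element of `e` plus a combination of strictly
later ones, then the converse holds as well, provided there is no infinite increasing chain of
indices. -/
theorem sub_mem_span_of_unitriangular {ι V : Type*} [AddCommGroup V] [Module ℚ V]
    {r : ι → ι → Prop} (hwf : WellFounded (flip r)) (htrans : ∀ a b c, r a b → r b c → r a c)
    {e B : ι → V} (h : ∀ w, B w - e w ∈ Submodule.span ℚ (e '' {u | r w u})) (w : ι) :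
    e w - B w ∈ Submodule.span ℚ (B '' {u | r w u}) := by
  induction w using hwf.induction with
  | _ w ih =>
    have hle : Submodule.span ℚ (e '' {u | r w u}) ≤ Submodule.span ℚ (B '' {u | r w u}) := by
      refine Submodule.span_le.mpr ?_
      rintro _ ⟨u, hu, rfl⟩
      have h1 := Submodule.span_mono (Set.image_mono fun x (hx : r u x) => htrans w u x hu hx)
        (ih u hu)
      have h2 : B u ∈ Submodule.span ℚ (B '' {u | r w u}) :=
        Submodule.subset_span ⟨u, hu, rfl⟩
      rw [← sub_add_cancel (e u) (B u)]
      exact add_mem h1 h2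
    rw [← neg_sub]
    exact neg_mem (hle (h w))

/-- A strict order in which every element has finitely many successors is well-founded upwards. -/
theorem wellFounded_flip_of_finite {ι : Type*} {r : ι → ι → Prop} (hirr : ∀ a, ¬ r a a)
    (htrans : ∀ a b c, r a b → r b c → r a c) (hfin : ∀ w, {u | r w u}.Finite) :
    WellFounded (flip r) := by
  refine Subrelation.wf (r := InvImage (· < ·) fun w => {u | r w u}.ncard) ?_
    (InvImage.wf _ Nat.lt_wfRel.wf)
  intro u w (huw : r w u)
  exact Set.ncard_lt_ncard ⟨fun x hx => htrans w u x huw hx, fun hsub => hirr u (hsub huw)⟩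
    (hfin w)

/-! ### Coefficients, spans of words and the pairing -/

theorem mono_append (u v : Word) : mono (u ++ v) = mono u * mono v := by
  simp [mono, MonoidAlgebra.single_mul_single]

theorem mono_nil : mono [] = 1 := rfl

theorem coeff_mono (u w : Word) : coeff (mono u) w = if u = w then 1 else 0 := by
  classical
  refine (Finsupp.single_apply (a := FreeMonoid.ofList u) (a' := FreeMonoid.ofList w)).trans ?_
  simp only [FreeMonoid.ofList.injective.eq_iff]

theorem coeff_sub (p q : Poly) (w : Word) : coeff (p - q) w = coeff p w - coeff q w := rfl

theorem poly_ext {p q : Poly} (h : ∀ w, coeff p w = coeff q w) : p = q :=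
  MonoidAlgebra.coeff_injective (Finsupp.ext h)

theorem poly_eq_sum (p : Poly) :
    p = ∑ u ∈ p.coeff.support, coeff p (FreeMonoid.toList u) • mono (FreeMonoid.toList u) := by
  conv_lhs => rw [← MonoidAlgebra.sum_coeff_single p]
  refine Finset.sum_congr rfl fun u _ => ?_
  simp [mono, coeff]

/-- The polynomials all of whose words lie in `s`. -/
noncomputable def wordSpan (s : Set Word) : Submodule ℚ Poly := Submodule.span ℚ (mono '' s)

theorem mono_mem_wordSpan {s : Set Word} {w : Word} (h : w ∈ s) : mono w ∈ wordSpan s :=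
  Submodule.subset_span ⟨w, h, rfl⟩

theorem wordSpan_mono {s t : Set Word} (h : s ⊆ t) : wordSpan s ≤ wordSpan t :=
  Submodule.span_mono (Set.image_mono h)

theorem coeff_eq_zero_of_mem_wordSpan {s : Set Word} {p : Poly} (hp : p ∈ wordSpan s) {w : Word}
    (hw : w ∉ s) : coeff p w = 0 := by
  induction hp using Submodule.span_induction with
  | mem x hx =>
    obtain ⟨u, hu, rfl⟩ := hx
    rw [coeff_mono, if_neg]
    rintro rfl
    exact hw hu
  | zero => rfl
  | add x y _ _ hx hy => exact (congrArg₂ (· + ·) hx hy).trans (add_zero 0)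
  | smul a x _ hx => exact (congrArg (a * ·) hx).trans (mul_zero a)

theorem mem_wordSpan_of_coeff {s : Set Word} {p : Poly} (h : ∀ w, w ∉ s → coeff p w = 0) :
    p ∈ wordSpan s := by
  rw [poly_eq_sum p]
  refine Submodule.sum_mem _ fun u _ => ?_
  by_cases hu : FreeMonoid.toList u ∈ s
  · exact Submodule.smul_mem _ _ (mono_mem_wordSpan hu)
  · rw [h _ hu, zero_smul]
    exact Submodule.zero_mem _

theorem mul_mem_wordSpan {s t r : Set Word} {p q : Poly} (hp : p ∈ wordSpan s)
    (hq : q ∈ wordSpan t) (h : ∀ u ∈ s, ∀ v ∈ t, u ++ v ∈ r) : p * q ∈ wordSpan r := by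
  have h1 := Submodule.mul_mem_mul hp hq
  rw [wordSpan, wordSpan, Submodule.span_mul_span] at h1
  refine Submodule.span_mono ?_ h1
  rintro _ ⟨_, ⟨u, hu, rfl⟩, _, ⟨v, hv, rfl⟩, rfl⟩
  exact ⟨u ++ v, h u hu v hv, mono_append u v⟩

/-- The pairing with a fixed right argument, as a linear map. -/
noncomputable def pairingLeft (q : Poly) : Poly →ₗ[ℚ] ℚ where
  toFun p := pairing p q
  map_add' p p' := by
    simp only [pairing, MonoidAlgebra.coeff_add]
    exact Finsupp.sum_add_index' (fun _ => zero_mul _) fun _ _ _ => add_mul _ _ _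
  map_smul' a p := by
    simp only [pairing, MonoidAlgebra.coeff_smul, RingHom.id_apply, smul_eq_mul]
    rw [Finsupp.sum_smul_index (fun _ => zero_mul _), Finsupp.mul_sum]
    simp only [mul_assoc]

theorem pairing_mono_left (w : Word) (q : Poly) : pairing (mono w) q = coeff q w := by
  simp [pairing, mono, coeff]

/-! ### Duality for unitriangular families -/

theorem mono_eq_add_sum {B : Word → Poly} {w : Word} {s : Set Word}
    (h : mono w - B w ∈ Submodule.span ℚ (B '' s)) :
    ∃ α : Word →₀ ℚ, (∀ u ∈ α.support, u ∈ s) ∧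
      mono w = B w + α.sum fun u a => a • B u := by
  obtain ⟨α, hα, h⟩ := (Finsupp.mem_span_image_iff_linearCombination ℚ).mp h
  refine ⟨α, fun u hu => (Finsupp.mem_supported ℚ α).mp hα hu, ?_⟩
  rw [← sub_eq_iff_eq_add', ← h, Finsupp.linearCombination_apply]

/-- There is no infinite increasing chain of words of constant degree when the classes of words of
equal degree are finite; `wellFounded_degree_gt` is the same for decreasing chains. -/
theorem wellFounded_degree_lt {M : Type*} {d : Word → M} (hfin : ∀ m, {w | d w = m}.Finite) :
    WellFounded (flip fun w u : Word => w < u ∧ d u = d w) :=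
  wellFounded_flip_of_finite (fun _ h => lt_irrefl _ h.1)
    (fun _ _ _ h h' => ⟨h.1.trans h'.1, h'.2.trans h.2⟩)
    fun w => (hfin (d w)).subset fun _ h => h.2

theorem wellFounded_degree_gt {M : Type*} {d : Word → M} (hfin : ∀ m, {w | d w = m}.Finite) :
    WellFounded (flip fun w u : Word => u < w ∧ d u = d w) :=
  wellFounded_flip_of_finite (fun _ h => lt_irrefl _ h.1)
    (fun _ _ _ h h' => ⟨h'.1.trans h.1, h'.2.trans h.2⟩)
    fun w => (hfin (d w)).subset fun _ h => h.2

/-- If the words expand in `B` as `w = B_w + ∑ α_{w,u} B_u`, then a family `C` is dual to `B` if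
and only if the coefficient of `w` in `C_v` is `δ_{w,v} + α_{w,v}`. -/
theorem isDual_iff_coeff {r : Word → Word → Prop} (hwf : WellFounded (flip r))
    {B C : Word → Poly} {α : Word → Word →₀ ℚ} (hr : ∀ w, ∀ u ∈ (α w).support, r w u)
    (hα : ∀ w, mono w = B w + (α w).sum fun u a => a • B u) :
    IsDual B C ↔ ∀ v w, coeff (C v) w = (if w = v then 1 else 0) + α w v := by
  have key : ∀ v w, coeff (C v) w =
      pairing (B w) (C v) + (α w).sum fun u a => a * pairing (B u) (C v) := by
    intro v w
    have h := congrArg (pairingLeft (C v)) (hα w)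
    rw [map_add, map_finsuppSum] at h
    simp only [map_smul, smul_eq_mul] at h
    exact (pairing_mono_left w (C v)).symm.trans h
  have hsum : ∀ v w, ((α w).sum fun u a => a * if u = v then (1 : ℚ) else 0) = α w v := by
    intro v w
    simp [eq_comm]
  constructor
  · intro h v w
    rw [key, h w v]
    simp only [h _ v]
    rw [hsum]
  · intro h u v
    induction u using hwf.induction with
    | _ u ih =>
      have h1 := key v u
      rw [h v u, Finsupp.sum_congr (g2 := fun x a => a * if x = v then (1 : ℚ) else 0)
        fun x hx => by rw [ih x (hr u x hx)], hsum] at h1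
      exact (add_right_cancel h1).symm

/-- A family that is unitriangular with respect to the words, within the finite classes of words
of equal degree, has exactly one dual family, and both families expand the words triangularly. -/
theorem duality_of_unitriangular {M : Type*} {d : Word → M} (hfin : ∀ m, {w | d w = m}.Finite)
    {B : Word → Poly} (hB : ∀ w, B w - mono w ∈ wordSpan {u | w < u ∧ d u = d w}) :
    (∀ C : Word → Poly, IsDual B C ↔ C = dualFamily B) ∧ ∀ w : Word,
      (∃ α : Word →₀ ℚ, (∀ u ∈ α.support, w < u ∧ d u = d w) ∧
        mono w = B w + α.sum fun u a => a • B u) ∧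
      (∃ α : Word →₀ ℚ, (∀ u ∈ α.support, u < w ∧ d u = d w) ∧
        mono w = dualFamily B w + α.sum fun u a => a • dualFamily B u) := by
  classical
  have hwf := wellFounded_degree_lt hfin
  have hup : ∀ w, ∃ α : Word →₀ ℚ, (∀ u ∈ α.support, w < u ∧ d u = d w) ∧
      mono w = B w + α.sum fun u a => a • B u := fun w =>
    mono_eq_add_sum (sub_mem_span_of_unitriangular hwf
      (fun _ _ _ h h' => ⟨h.1.trans h'.1, h'.2.trans h.2⟩) hB w)
  choose α hr hα using hup
  have hiff := fun C : Word → Poly => isDual_iff_coeff (C := C) hwf hr hα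
  have hz : ∀ w v, ¬ (w < v ∧ d v = d w) → α w v = 0 := fun w v h =>
    Finsupp.notMem_support_iff.mp fun hv => h (hr w v hv)
  have hex : ∃ C, IsDual B C := by
    refine ⟨fun v => ∑ u ∈ (hfin (d v)).toFinset, ((if u = v then 1 else 0) + α u v) • mono u,
      (hiff _).mpr fun v w => ?_⟩
    have h1 : coeff (∑ u ∈ (hfin (d v)).toFinset, ((if u = v then 1 else 0) + α u v) • mono u) w =
        ∑ u ∈ (hfin (d v)).toFinset, ((if u = v then 1 else 0) + α u v) * coeff (mono u) w := by
      simp only [coeff, MonoidAlgebra.coeff_sum, Finsupp.finsetSum_apply,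
        MonoidAlgebra.coeff_smul_apply, smul_eq_mul]
    rw [h1]
    simp only [coeff_mono, mul_ite, mul_one, mul_zero, Finset.sum_ite_eq', Set.Finite.mem_toFinset,
      Set.mem_ofPred_eq]
    split_ifs with h2 h3 h3
    · rfl
    · rfl
    · exact absurd (congrArg d h3) h2
    · rw [hz w v fun h => h2 h.2.symm, add_zero]
  have hdual : IsDual B (dualFamily B) := by
    rw [dualFamily, dif_pos hex]
    exact hex.choose_spec
  have hcoeff := (hiff _).mp hdual
  refine ⟨fun C => ⟨fun hC => ?_, fun hC => hC ▸ hdual⟩, fun w => ⟨⟨α w, hr w, hα w⟩, ?_⟩⟩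
  · funext v
    exact poly_ext fun w => ((hiff C).mp hC v w).trans (hcoeff v w).symm
  · refine mono_eq_add_sum (sub_mem_span_of_unitriangular (wellFounded_degree_gt hfin)
      (fun _ _ _ h h' => ⟨h'.1.trans h.1, h'.2.trans h.2⟩) (fun v => ?_) w)
    refine mem_wordSpan_of_coeff fun u hu => ?_
    rw [coeff_sub, hcoeff, coeff_mono, hz u v fun h => hu ⟨h.1, h.2.symm⟩]
    simp [eq_comm]

/-! ### The standard factorization -/

theorem le_append (u v : Word) : u ≤ u ++ v :=
  not_lt.mp (List.le_append_left (α := Letter) (l₁ := u) (l₂ := v))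

theorem append_lt_append_left_iff (u : Word) {v w : Word} : u ++ v < u ++ w ↔ v < w := by
  have key : ∀ {v w : Word}, v < w → u ++ v < u ++ w := fun h => List.append_left_lt h
  refine ⟨fun h => ?_, key⟩
  rcases lt_trichotomy v w with h' | h' | h'
  · exact h'
  · exact absurd h (h' ▸ lt_irrefl _)
  · exact absurd h (key h').asymm

theorem stRight_ne_nil {l : Word} (h : 2 ≤ l.length) : stRight l ≠ [] :=
  minSuffix_ne_nil _ fun h0 => by
    have := congrArg List.length h0
    rw [List.length_tail, List.length_nil] at this
    omega

theorem isLyndon_stRight {l : Word} (h : 2 ≤ l.length) : IsLyndon (stRight l) :=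
  isLyndon_minSuffix _ fun h0 => stRight_ne_nil h (by rw [stRight, h0]; rfl)

theorem stLeft_ne_nil {l : Word} (h : 2 ≤ l.length) : stLeft l ≠ [] := fun h0 => by
  have h1 := stLeft_append_stRight l
  have h2 := length_stRight_lt l h
  rw [h0, List.nil_append] at h1
  rw [h1] at h2
  exact lt_irrefl _ h2

theorem stRight_le {l u v : Word} (hu : u ≠ []) (hv : v ≠ []) (h : l = u ++ v) :
    stRight l ≤ v := by
  obtain ⟨a, u, rfl⟩ := List.exists_cons_of_ne_nil hu
  subst h
  exact minSuffix_le _ v hv ⟨u, rfl⟩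

theorem isLyndon_stLeft {l : Word} (h : 2 ≤ l.length) (hl : IsLyndon l) : IsLyndon (stLeft l) := by
  refine ⟨stLeft_ne_nil h, fun u v hu hv e => ?_⟩
  have e' : l = u ++ (v ++ stRight l) := by
    rw [← List.append_assoc, ← e, stLeft_append_stRight]
  have hlt : l < v ++ stRight l := hl.2 u _ hu (by simp [hv]) e'
  by_contra hle
  have hne : v ≠ stLeft l := fun h0 => hu (List.self_eq_append_left.mp (h0.trans e))
  rcases lt_cases v (stLeft l) (lt_of_le_of_ne (not_lt.mp hle) hne) with ⟨t, ht, e2⟩ | h2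
  · -- here `l = v t l₂ < v l₂`, so `t l₂ < l₂`, against the minimality of `l₂`
    have e3 : l = v ++ (t ++ stRight l) := by
      rw [← List.append_assoc, ← e2, stLeft_append_stRight]
    have h3 : v ++ (t ++ stRight l) < v ++ stRight l := e3 ▸ hlt
    exact absurd ((append_lt_append_left_iff v).mp h3)
      (not_lt.mpr (stRight_le hv (by simp [ht]) e3))
  · have h3 := (h2 (stRight l)).trans_le (le_append (stLeft l) (stRight l))
    rw [stLeft_append_stRight] at h3
    exact h3.asymm hlt

/-- For the standard factorization `l = l₁ l₂`, the word `l₂ l₁` exceeds `l` at a letter: it is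
larger than `l` and has the same length. -/
theorem append_lt_stRight_append_stLeft {l : Word} (h : 2 ≤ l.length) (hl : IsLyndon l)
    (x : Word) : l ++ x < stRight l ++ stLeft l := by
  have h1 : l < stRight l ++ stLeft l :=
    (hl.2 _ _ (stLeft_ne_nil h) (stRight_ne_nil h) (stLeft_append_stRight l).symm).trans_le
      (le_append _ _)
  rcases lt_cases _ _ h1 with ⟨t, ht, e⟩ | h2
  · have e1 := congrArg List.length e
    have e2 := congrArg List.length (stLeft_append_stRight l)
    have := List.length_pos_of_ne_nil ht
    simp only [List.length_append] at e1 e2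
    omega
  · exact h2 x

/-! ### Leading words -/

/-- The words of the same degree as `w` that exceed `w` at a letter, not just by extending `w`:
`w x < u` for every `x`. -/
def above {M : Type*} (d : Word → M) (w : Word) : Set Word :=
  {u | (∀ x : Word, w ++ x < u) ∧ d u = d w}

/-- `p` is `w` plus a combination of words in `above d w`. -/
def HasLeading {M : Type*} (d : Word → M) (p : Poly) (w : Word) : Prop :=
  p - mono w ∈ wordSpan (above d w)

theorem HasLeading.mem_degree {M : Type*} {d : Word → M} {p : Poly} {w : Word}
    (h : HasLeading d p w) :
    p ∈ wordSpan {u | d u = d w} := by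
  have := add_mem (wordSpan_mono (fun u (hu : u ∈ above d w) => hu.2) h)
    (mono_mem_wordSpan (s := {u | d u = d w}) (w := w) rfl)
  rwa [sub_add_cancel] at this

theorem HasLeading.mem_wordSpan_lt {M : Type*} {d : Word → M} {p : Poly} {w : Word}
    (h : HasLeading d p w) :
    p - mono w ∈ wordSpan {u | w < u ∧ d u = d w} :=
  wordSpan_mono (fun u (hu : u ∈ above d w) => And.intro (by simpa using hu.1 []) hu.2) h

section Degree

variable {M : Type*} [AddCommMonoid M] {d : Word → M}

/-- Leading words multiply, since exceeding a word at a letter is preserved by appending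
arbitrary words on the right. -/
theorem HasLeading.mul (hd : ∀ u v, d (u ++ v) = d u + d v) {p q : Poly} {w w' : Word}
    (hp : HasLeading d p w) (hq : HasLeading d q w') : HasLeading d (p * q) (w ++ w') := by
  have e : p * q - mono (w ++ w') = mono w * (q - mono w') + (p - mono w) * q := by
    rw [mono_append]
    noncomm_ring
  rw [HasLeading, e]
  refine add_mem (mul_mem_wordSpan (mono_mem_wordSpan (Set.mem_singleton w)) hq ?_)
    (mul_mem_wordSpan hp hq.mem_degree ?_)
  · rintro _ rfl v ⟨hv, hv'⟩
    refine ⟨fun x => ?_, by rw [hd, hd, hv']⟩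
    rw [List.append_assoc]
    exact List.append_left_lt (hv x)
  · rintro u ⟨hu, hu'⟩ v (hv : d v = d w')
    refine ⟨fun x => ?_, by rw [hd, hd, hu', hv]⟩
    rw [List.append_assoc]
    exact (hu _).trans_le (le_append u v)

theorem hasLeading_prod (hd : ∀ u v, d (u ++ v) = d u + d v) {f : Word → Poly} (L : List Word)
    (h : ∀ l ∈ L, HasLeading d (f l) l) : HasLeading d (L.map f).prod L.flatten := by
  induction L with
  | nil => simp [HasLeading, mono_nil]
  | cons l L ih =>
    rw [List.map_cons, List.prod_cons, List.flatten_cons]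
    exact (h l (by simp)).mul hd (ih fun l' hl' => h l' (by simp [hl']))

/-- In `[p₁, p₂]` only `p₁ p₂` contributes to the leading word: every word of `p₂ p₁` is at least
`l₂ l₁`, which exceeds `l = l₁ l₂` at a letter. -/
theorem hasLeading_bracket (hd : ∀ u v, d (u ++ v) = d u + d v) {g : Letter → Poly}
    (hg : ∀ a, HasLeading d (g a) [a]) :
    ∀ l : Word, IsLyndon l → HasLeading d (bracket g l) l
  | [], hl => absurd rfl hl.1
  | [a], _ => by
    rw [bracket]
    exact hg a
  | a :: b :: t, hl => by
    have h : 2 ≤ (a :: b :: t).length := by simp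
    have hL := hasLeading_bracket hd hg _ (isLyndon_stLeft h hl)
    have hR := hasLeading_bracket hd hg _ (isLyndon_stRight h)
    have e := stLeft_append_stRight (a :: b :: t)
    have hsw := append_lt_stRight_append_stLeft h hl
    rw [bracket]
    generalize a :: b :: t = l at *
    have h1 := hL.mul hd hR
    rw [e] at h1
    have h2 : d (stRight l ++ stLeft l) = d l := by
      conv_rhs => rw [← e, hd, add_comm, ← hd]
    have h3 : bracket g (stRight l) * bracket g (stLeft l) ∈ wordSpan (above d l) := by
      have hsub : above d (stRight l ++ stLeft l) ⊆ above d l := by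
        intro u hu
        exact ⟨fun x => (hsw x).trans (by simpa using hu.1 []), hu.2.trans h2⟩
      have h4 := wordSpan_mono hsub (hR.mul hd hL)
      have h5 : mono (stRight l ++ stLeft l) ∈ wordSpan (above d l) :=
        mono_mem_wordSpan ⟨hsw, h2⟩
      have h6 := add_mem h4 h5
      rwa [sub_add_cancel] at h6
    rw [HasLeading, sub_right_comm]
    exact sub_mem h1 h3
termination_by l => l.length
decreasing_by
  all_goals first
    | exact length_stLeft_lt _ (by simp)
    | exact length_stRight_lt _ (by simp)

theorem hasLeading_pbwFamily (hd : ∀ u v, d (u ++ v) = d u + d v) {g : Letter → Poly}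
    (hg : ∀ a, HasLeading d (g a) [a]) (w : Word) : HasLeading d (pbwFamily g w) w := by
  obtain ⟨h1, -, h3⟩ := (exists_isLyndonFactorization w).choose_spec
  have := hasLeading_prod hd (f := bracket g) (lyndonFactors w)
    fun l hl => hasLeading_bracket hd hg l (h1 l hl)
  rwa [show (lyndonFactors w).flatten = w from h3] at this

end Degree

/-! ### Weights -/

theorem weight_append (u v : Word) : weight (u ++ v) = weight u + weight v := by
  simp [weight]

theorem weight_cons (a : Letter) (v : Word) : weight (a :: v) = idx a + weight v := by
  simp [weight]

theorem weight_pos {w : Word} (h : w ≠ []) : 0 < weight w := by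
  obtain ⟨a, v, rfl⟩ := List.exists_cons_of_ne_nil h
  rw [weight_cons]
  exact Nat.add_pos_left (idx a).pos _

/-- A word of weight `n` is a composition of `n`, so there are finitely many. -/
theorem finite_weight_eq (n : ℕ) : {w : Word | weight w = n}.Finite := by
  let f : {w : Word // weight w = n} → Composition n := fun w =>
    ⟨w.1.map fun a => (idx a : ℕ), fun hi => by
      obtain ⟨a, -, rfl⟩ := List.mem_map.mp hi
      exact (idx a).pos, w.2⟩
  have hf : Function.Injective f := fun u v h => by
    have h1 : u.1.map (fun a => (idx a : ℕ)) = v.1.map fun a => (idx a : ℕ) :=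
      congrArg Composition.blocks h
    exact Subtype.ext (List.map_injective_iff.mpr
      (PNat.coe_injective.comp OrderDual.ofDual.injective) h1)
  exact Set.finite_coe_iff.mp (Finite.of_injective f hf)

/-! ### The letters of the second basis -/

theorem mono_mul_mem_weight (a : Letter) {p : Poly} {m n : ℕ}
    (hp : p ∈ wordSpan {x | weight x = n}) (h : idx a + n = m) :
    mono [a] * p ∈ wordSpan {x | weight x = m} := by
  refine mul_mem_wordSpan (mono_mem_wordSpan (Set.mem_singleton _)) hp ?_
  rintro _ rfl x (rfl : weight x = n)
  exact (weight_cons a x).trans h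

theorem stuffle_mem_weight : ∀ u v : Word,
    stuffle u v ∈ wordSpan {x | weight x = weight u + weight v}
  | [], v => by
    rw [stuffle]
    exact mono_mem_wordSpan (by simp [weight])
  | a :: u, [] => by
    rw [stuffle]
    exact mono_mem_wordSpan (by simp [weight])
  | a :: u, b :: v => by
    rw [stuffle]
    refine add_mem (add_mem (mono_mul_mem_weight a (stuffle_mem_weight u (b :: v)) ?_)
      (mono_mul_mem_weight b (stuffle_mem_weight (a :: u) v) ?_))
      (mono_mul_mem_weight _ (stuffle_mem_weight u v) ?_)
    · simp only [weight_cons]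
      ring
    · simp only [weight_cons]
      ring
    · have : ((idx (y (idx a + idx b)) : ℕ+) : ℕ) = idx a + idx b := rfl
      simp only [weight_cons, this]
      ring
termination_by u v => u.length + v.length

theorem stufflePoly_mem_weight {p : Poly} {n : ℕ} (u : Word)
    (hp : p ∈ wordSpan {x | weight x = n}) :
    stufflePoly (mono u) p ∈ wordSpan {x | weight x = weight u + n} := by
  have e : stufflePoly (mono u) p =
      p.coeff.sum fun v b => b • stuffle u (FreeMonoid.toList v) := by
    simp [stufflePoly, mono]
  rw [e]
  refine Submodule.sum_mem _ fun v hv => Submodule.smul_mem _ _ ?_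
  have hv' : weight (FreeMonoid.toList v) = n := by
    by_contra hne
    exact Finsupp.mem_support_iff.mp hv (coeff_eq_zero_of_mem_wordSpan hp hne)
  rw [← hv']
  exact stuffle_mem_weight u _

theorem stuffleList_mem_weight (L : List Word) :
    stuffleList L ∈ wordSpan {x | weight x = weight L.flatten} := by
  induction L with
  | nil => exact mono_mem_wordSpan rfl
  | cons u L ih =>
    have := stufflePoly_mem_weight u ih
    rwa [← weight_append] at this

/-- `π_1(y_s)` is `y_s` plus words `u_1 ⋯ u_k`, `k ≥ 2`, of weight `s`; such a word begins with a
letter of index less than `s`, that is, with a letter larger than `y_s`. -/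
theorem hasLeading_piOne (a : Letter) : HasLeading weight (piOne [a]) [a] := by
  rw [HasLeading, piOne, add_sub_cancel_left]
  refine Submodule.sum_mem _ fun k hk => Submodule.smul_mem _ _ ?_
  refine finsum_induction (p := (· ∈ wordSpan (above weight [a]))) (Submodule.zero_mem _)
    (fun _ _ => Submodule.add_mem _) ?_
  rintro ⟨L, hL, hnil⟩
  by_cases hc : weight L.flatten = weight [a]
  · refine Submodule.smul_mem _ _ (mono_mem_wordSpan ⟨fun x => ?_, hc⟩)
    have hk2 := (Finset.mem_Icc.mp hk).1
    match L, hL, hnil, hc with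
    | [], hL, _, _ => simp at hL; omega
    | [_], hL, _, _ => simp at hL; omega
    | [] :: _ :: _, _, hnil, _ => simp at hnil
    | (c :: u) :: v :: K, _, hnil, hc =>
      have hv : 0 < weight v := weight_pos fun h0 => hnil (by simp [h0])
      have hlt : idx c < idx a := by
        simp only [List.flatten_cons, weight_append, weight_cons] at hc
        rw [show weight [] = 0 from rfl] at hc
        rw [← PNat.coe_lt_coe]
        omega
      exact List.cons_lt_cons_iff.mpr (Or.inl hlt)
  · rw [coeff_eq_zero_of_mem_wordSpan (stuffleList_mem_weight L) (Ne.symm hc), zero_smul]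
    exact Submodule.zero_mem _

end PBW

theorem mainTheorem4 :
    (∀ C : PBW.Word → PBW.Poly, PBW.IsDual PBW.P C ↔ C = PBW.S) ∧
    (∀ C : PBW.Word → PBW.Poly, PBW.IsDual PBW.Pi C ↔ C = PBW.Sigma) ∧
    ∀ w : PBW.Word,
      (∃ α : PBW.Word →₀ ℚ, (∀ u ∈ α.support, w < u ∧ u.length = w.length) ∧
        PBW.mono w = PBW.P w + α.sum fun u a => a • PBW.P u) ∧
      (∃ α : PBW.Word →₀ ℚ, (∀ u ∈ α.support, u < w ∧ u.length = w.length) ∧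
        PBW.mono w = PBW.S w + α.sum fun u a => a • PBW.S u) ∧
      (∃ β : PBW.Word →₀ ℚ, (∀ v ∈ β.support, w < v ∧ PBW.weight v = PBW.weight w) ∧
        PBW.mono w = PBW.Pi w + β.sum fun v b => b • PBW.Pi v) ∧
      (∃ β : PBW.Word →₀ ℚ, (∀ v ∈ β.support, v < w ∧ PBW.weight v = PBW.weight w) ∧
        PBW.mono w = PBW.Sigma w + β.sum fun v b => b • PBW.Sigma v) := by
  -- Infinitely many words share a length, so for `P` the weight is recorded along with it.
  let d : PBW.Word → ℕ × ℕ := fun w => (w.length, PBW.weight w)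
  have hfin : ∀ m, {w | d w = m}.Finite := fun m =>
    (PBW.finite_weight_eq m.2).subset fun w hw => congrArg Prod.snd hw
  have hP := PBW.duality_of_unitriangular hfin fun w =>
    (PBW.hasLeading_pbwFamily (d := d) (g := fun a => PBW.mono [a])
      (fun u v => by simp [d, PBW.weight_append])
      (fun a => by simp [PBW.HasLeading]) w).mem_wordSpan_lt
  have hPi := PBW.duality_of_unitriangular PBW.finite_weight_eq fun w =>
    (PBW.hasLeading_pbwFamily PBW.weight_append PBW.hasLeading_piOne w).mem_wordSpan_lt
  refine ⟨hP.1, hPi.1, fun w => ⟨?_, ?_, (hPi.2 w).1, (hPi.2 w).2⟩⟩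
  · obtain ⟨α, h, e⟩ := (hP.2 w).1
    exact ⟨α, fun u hu => ⟨(h u hu).1, congrArg Prod.fst (h u hu).2⟩, e⟩
  · obtain ⟨α, h, e⟩ := (hP.2 w).2
    exact ⟨α, fun u hu => ⟨(h u hu).1, congrArg Prod.fst (h u hu).2⟩, e⟩
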